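/- Let $\eta\in\mathbb C$ with $\operatorname{Im}\eta<0$, and put $q=e^{-2\pi i\eta}$ (so $0<|q|<1$), $q^{m^2/2}:=e^{-\pi i\eta m^2}$ for $m\in\mathbb Z$, and $x=e^{\pi i\lambda}$. A Laurent polynomial $f\in\mathbb C[x,x^{-1}]$ is regarded also as the function $\lambda\mapsto f(e^{\pi i\lambda})$, and is called symmetric if $f(x^{-1})=f(x)$. Let $P^{(2)}_j(x)=P^{(2)}_j(x,q)\in\mathbb C[x,x^{-1}]$, $j=0,1,2,\dots$, be the $A_1$-Macdonald polynomials: $P^{(2)}_j=x^j+$ terms of lower degree, $P^{(2)}_j$ is symmetric, and for $j\ne k$ the constant term of $P^{(2)}_j(x)P^{(2)}_k(x^{-1})\prod_{i=0}^{1}(1-q^{2i}x^2)(1-q^{2i}x^{-2})$ is $0$. There is exactly one such family. Define the infinite-order difference operator $$T(q)=\frac12\sum_{m\in\mathbb Z}\frac{q^{-2}\cos\pi(2\eta m)-\cos\pi(2\lambda-2\eta m)}{\sin\pi(\lambda-2\eta)\,\sin\pi\lambda\,\sin\pi(\lambda+2\eta)}\,\sin\pi(\lambda-2\eta m)\;q^{m^2/2}\,T_{-2\eta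 m},\qquad (T_{-2\eta m}v)(\lambda)=v(\lambda-2\eta m),$$ and $\theta_0(x,q)=\sum_{m\in\mathbb Z}x^mq^{m^2/2}$, a series which converges absolutely for every $x\in\mathbb C\setminus\{0\}$. (1) For every $j\ge0$ and every $\lambda$ with $\sin\pi(\lambda-2\eta)\sin\pi\lambda\sin\pi(\lambda+2\eta)\neq0$, the series defining $T(q)P^{(2)}_j(e^{\pi i\lambda})$ converges absolutely and $$T(q)\,P^{(2)}_j(e^{\pi i\lambda})=\theta_0(q^{j+2},q)\,P^{(2)}_j(e^{\pi i\lambda}).$$ (2) Let $Y$ be the Cherednik operator, that is, the invertible linear operator on $\mathbb C[x,x^{-1}]$ given by $$Y=\frac{q^{-2}-q^2x^2}{1-x^2}\,\Gamma+\frac{q^2-q^{-2}}{1-x^2}\,w,\qquad (\Gamma f)(x)=f(qx),\quad (wf)(x)=f(qx^{-1}).$$ Then $T(q)=\theta_0(Y,q)$ on symmetric Laurent polynomials. Precisely, for every symmetric $f$ all the $Y^mf$ $(m\in\mathbb Z)$ lie in a common finite-dimensional space of Laurent polynomials with bounded exponents, the series $\theta_0(Y,q)f=\sum_{m\in\mathbb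 Z}q^{m^2/2}\,Y^mf$ converges absolutely in it, its sum is again symmetric, and for every $\lambda$ as in (1) the series defining $T(q)f$ converges absolutely, with sum $(\theta_0(Y,q)f)(e^{\pi i\lambda})$. -/

import Mathlib

open Complex LaurentPolynomial

namespace EllipticMacdonald

noncomputable section

/-- The parameter `q = e^{-2πiη}`. -/
def qPar (η : ℂ) : ℂ := exp (-2 * Real.pi * I * η)

theorem qPar_ne_zero (η : ℂ) : qPar η ≠ 0 := exp_ne_zero _

/-- The Gaussian weight `q^{m²/2}`, that is `e^{-πiηm²}`. -/
def gauss (η : ℂ) (m : ℤ) : ℂ := exp (-(Real.pi * I * η * (m : ℂ) ^ 2))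

/-- The theta series `θ₀(x,q) = ∑_{m∈ℤ} x^m q^{m²/2}`. -/
def thetaZero (η x : ℂ) : ℂ := ∑' m : ℤ, x ^ m * gauss η m

/-- The function `z ↦ f(e^{πiz})` of an additive variable given by a Laurent polynomial `f`. -/
def toFun (f : ℂ[T;T⁻¹]) (z : ℂ) : ℂ :=
  f.coeff.sum fun n c => c * exp (Real.pi * I * z) ^ n

/-! ### Macdonald polynomials of type `A₁` -/

/-- The constant term of `P(x) Q(x⁻¹) ∏_{0 ≤ j < m} (1 - q^{2j} x²)(1 - q^{2j} x⁻²)`. -/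
def innerCT (q : ℂ) (m : ℕ) (P Q : ℂ[T;T⁻¹]) : ℂ :=
  (P * invert Q *
    ∏ j ∈ Finset.range m, (1 - C (q ^ (2 * j)) * T 2) * (1 - C (q ^ (2 * j)) * T (-2))).coeff 0

/-- `P j`, `j = 0, 1, 2, …`, are the Macdonald polynomials `P_j^{(m)}` of type `A₁` with
parameter `q`. -/
structure IsMacdonald (q : ℂ) (m : ℕ) (P : ℕ → ℂ[T;T⁻¹]) : Prop where
  leading : ∀ j : ℕ, (P j).coeff (j : ℤ) = 1
  lower : ∀ (j : ℕ) (n : ℤ), (j : ℤ) < n → (P j).coeff n = 0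
  symmetric : ∀ j : ℕ, invert (P j) = P j
  orthogonal : ∀ j k : ℕ, j ≠ k → innerCT q m (P j) (P k) = 0

/-! ### The infinite order difference operator -/

/-- The product of sines in the denominators of the coefficients of the operator `T(q)`. -/
def sinDenom (η z : ℂ) : ℂ :=
  sin (Real.pi * (z - 2 * η)) * sin (Real.pi * z) * sin (Real.pi * (z + 2 * η))

/-- The `m`-th term of `T(q)` applied to the function `v`, at the point `z`. -/
def opTTerm (η : ℂ) (v : ℂ → ℂ) (z : ℂ) (m : ℤ) : ℂ :=
  1 / 2 *
    ((qPar η ^ (-2 : ℤ) * cos (Real.pi * (2 * η * m)) - cos (Real.pi * (2 * z - 2 * η * m))) /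
      sinDenom η z) *
    sin (Real.pi * (z - 2 * η * m)) * gauss η m * v (z - 2 * η * m)

/-- The operator `T(q)`: the sum of its terms over all integers `m`. -/
def opT (η : ℂ) (v : ℂ → ℂ) (z : ℂ) : ℂ := ∑' m : ℤ, opTTerm η v z m

/-! ### The Cherednik operator -/

/-- The linear operator on Laurent polynomials with prescribed values on the monomials `x^n`. -/
def onMonomials (g : ℤ → ℂ[T;T⁻¹]) : ℂ[T;T⁻¹] →ₗ[ℂ] ℂ[T;T⁻¹] where
  toFun f := f.coeff.sum fun n c => c • g n
  map_add' f h := by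
    simp only [AddMonoidAlgebra.coeff_add]
    exact Finsupp.sum_add_index' (by simp) (by intros; rw [add_smul])
  map_smul' a f := by
    simp only [AddMonoidAlgebra.coeff_smul, RingHom.id_apply]
    rw [Finsupp.sum_smul_index (by simp), Finsupp.smul_sum]
    simp [mul_smul]

theorem onMonomials_T (g : ℤ → ℂ[T;T⁻¹]) (n : ℤ) : onMonomials g (T n) = g n := by
  change (Finsupp.single n (1 : ℂ)).sum (fun n c => c • g n) = g n
  rw [Finsupp.sum_single_index] <;> simp

theorem hom_ext {A B : ℂ[T;T⁻¹] →ₗ[ℂ] ℂ[T;T⁻¹]} (h : ∀ n, A (T n) = B (T n)) : A = B := by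
  refine LinearMap.ext fun f => ?_
  induction f using LaurentPolynomial.induction_on' with
  | add p r hp hr => rw [map_add, map_add, hp, hr]
  | C_mul_T n a => rw [← smul_eq_C_mul, map_smul, map_smul, h]

/-- `Γ_c : f(x) ↦ f(cx)`. -/
def dilate (c : ℂ) : ℂ[T;T⁻¹] →ₗ[ℂ] ℂ[T;T⁻¹] := onMonomials fun n => c ^ n • T n

theorem dilate_comp {c d : ℂ} (h : c * d = 1) : dilate c ∘ₗ dilate d = LinearMap.id := by
  refine hom_ext fun n => ?_
  simp [dilate, onMonomials_T, map_smul, smul_smul, ← mul_zpow, mul_comm d c, h]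

/-- `Γ : f(x) ↦ f(qx)`, as an automorphism of the space of Laurent polynomials. -/
def opGamma (η : ℂ) : ℂ[T;T⁻¹] ≃ₗ[ℂ] ℂ[T;T⁻¹] :=
  LinearEquiv.ofLinearMap (dilate (qPar η)) (dilate (qPar η)⁻¹)
    (dilate_comp (mul_inv_cancel₀ (qPar_ne_zero η)))
    (dilate_comp (inv_mul_cancel₀ (qPar_ne_zero η)))

/-- `w : f(x) ↦ f(qx⁻¹)`. -/
def opW (η : ℂ) : ℂ[T;T⁻¹] →ₗ[ℂ] ℂ[T;T⁻¹] :=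
  (invert : ℂ[T;T⁻¹] ≃ₐ[ℂ] ℂ[T;T⁻¹]).toLinearMap ∘ₗ dilate (qPar η)

/-- The divided difference `f(x) ↦ (f(x) - f(x⁻¹)) / (1 - x²)`, written out on monomials. -/
def divDiff : ℂ[T;T⁻¹] →ₗ[ℂ] ℂ[T;T⁻¹] :=
  onMonomials fun n =>
    (-(n.sign : ℂ)) • ∑ k ∈ Finset.range n.natAbs, T (2 * (k : ℤ) - (n.natAbs : ℤ))

theorem geom (n : ℕ) :
    (1 - T 2 : ℂ[T;T⁻¹]) * ∑ k ∈ Finset.range n, T (2 * (k : ℤ) - (n : ℤ)) = T (-n) - T n := by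
  have key : ∀ N : ℕ, (1 - T 2 : ℂ[T;T⁻¹]) * ∑ k ∈ Finset.range N, T (2 * (k : ℤ) - (n : ℤ)) =
      T (-n) - T (2 * N - n) := by
    intro N
    induction N with
    | zero => simp
    | succ N ih =>
      rw [Finset.sum_range_succ, mul_add, ih, sub_mul, one_mul, ← T_add]
      have : (2 + (2 * (N : ℤ) - n)) = 2 * ((N + 1 : ℕ) : ℤ) - n := by push_cast; ring
      rw [this]; abel
  rw [key n]; congr 2; ring

/-- The divided difference is what its name says. -/
theorem divDiff_spec (f : ℂ[T;T⁻¹]) : (1 - T 2) * divDiff f = f - invert f := by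
  have : LinearMap.mulLeft ℂ (1 - T 2 : ℂ[T;T⁻¹]) ∘ₗ divDiff =
      LinearMap.id - (invert : ℂ[T;T⁻¹] ≃ₐ[ℂ] ℂ[T;T⁻¹]).toLinearMap := by
    refine hom_ext fun n => ?_
    simp only [LinearMap.comp_apply, LinearMap.mulLeft_apply, divDiff, onMonomials_T,
      LinearMap.sub_apply, LinearMap.id_apply, AlgEquiv.toLinearMap_apply, invert_T,
      mul_smul_comm, geom]
    rcases lt_trichotomy n 0 with h | h | h
    · rw [Int.sign_eq_neg_one_of_neg h]
      have : (n.natAbs : ℤ) = -n := by omega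
      simp [this]
    · subst h; simp
    · rw [Int.sign_eq_one_of_pos h]
      have : (n.natAbs : ℤ) = n := by omega
      simp [this]
  exact LinearMap.congr_fun this f

theorem one_sub_T_ne : (1 - T 2 : ℂ[T;T⁻¹]) ≠ 0 := by
  intro h
  have := congrArg (fun f : ℂ[T;T⁻¹] => f.coeff 2) h
  rw [← T_zero] at this
  simp [-T_zero] at this

theorem divDiff_idem (f : ℂ[T;T⁻¹]) : divDiff (divDiff f) = divDiff f := by
  have h := divDiff_spec f
  have h2 := congrArg (invert : ℂ[T;T⁻¹] ≃ₐ[ℂ] ℂ[T;T⁻¹]) h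
  simp only [map_mul, map_sub, map_one, invert_T] at h2
  have hT : (T 2 : ℂ[T;T⁻¹]) * T (-2) = 1 := by rw [← T_add]; simp
  have hi : invert (invert f) = f := involutive_invert f
  have h3 : invert (divDiff f) = T 2 * divDiff f := by
    apply mul_left_cancel₀ one_sub_T_ne
    simp only [hi] at h2
    linear_combination (-T 2) * h2 - T 2 * h - invert (divDiff f) * hT
  apply mul_left_cancel₀ one_sub_T_ne
  rw [divDiff_spec, h3]; ring

/-- `f ↦ ((q⁻² - q²x²) f(x) + (q² - q⁻²) f(x⁻¹)) / (1 - x²)` for `s = q²`. -/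
def hecke (s : ℂ) : ℂ[T;T⁻¹] →ₗ[ℂ] ℂ[T;T⁻¹] := s • LinearMap.id + (s⁻¹ - s) • divDiff

theorem hecke_comp {s : ℂ} (hs : s ≠ 0) : hecke s ∘ₗ hecke s⁻¹ = LinearMap.id := by
  refine LinearMap.ext fun f => ?_
  simp only [hecke, LinearMap.comp_apply, LinearMap.add_apply, LinearMap.smul_apply,
    LinearMap.id_apply, map_add, map_smul, divDiff_idem, inv_inv]
  have : (s * s⁻¹) = 1 := mul_inv_cancel₀ hs
  match_scalars
  · linear_combination this
  · ring

def heckeEquiv {s : ℂ} (hs : s ≠ 0) : ℂ[T;T⁻¹] ≃ₗ[ℂ] ℂ[T;T⁻¹] :=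
  LinearEquiv.ofLinearMap (hecke s) (hecke s⁻¹) (hecke_comp hs)
    (by simpa using hecke_comp (inv_ne_zero hs))

/-- The Cherednik operator
`Y = (q⁻² - q²x²)/(1 - x²) Γ + (q² - q⁻²)/(1 - x²) w`
on Laurent polynomials; see `opY_spec`. -/
def opY (η : ℂ) : ℂ[T;T⁻¹] ≃ₗ[ℂ] ℂ[T;T⁻¹] :=
  (opGamma η).trans (heckeEquiv (pow_ne_zero 2 (qPar_ne_zero η)))

theorem opY_spec (η : ℂ) (f : ℂ[T;T⁻¹]) :
    (1 - T 2) * opY η f =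
      (C ((qPar η)⁻¹ ^ 2) - C (qPar η ^ 2) * T 2) * opGamma η f +
        C (qPar η ^ 2 - (qPar η)⁻¹ ^ 2) * opW η f := by
  have h := divDiff_spec (opGamma η f)
  have h1 : opY η f = C (qPar η ^ 2) * opGamma η f +
      C ((qPar η ^ 2)⁻¹ - qPar η ^ 2) * divDiff (opGamma η f) := by
    rw [← smul_eq_C_mul, ← smul_eq_C_mul]; rfl
  have h2 : opW η f = invert (opGamma η f) := rfl
  rw [h1, h2, ← inv_pow, map_sub, map_sub]
  linear_combination (C ((qPar η)⁻¹ ^ 2) - C (qPar η ^ 2)) * h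

/-- `g = θ₀(Y,q) f = ∑_{m∈ℤ} q^{m²/2} Y^m f`, for Laurent polynomials `f` and `g`: all the terms
lie in one finite-dimensional space of Laurent polynomials with bounded exponents, in which the
series converges unconditionally to `g`. -/
def IsThetaZeroY (η : ℂ) (f g : ℂ[T;T⁻¹]) : Prop :=
  (∃ N : ℕ, ∀ (m n : ℤ), (N : ℤ) < |n| → ((opY η ^ m) f).coeff n = 0) ∧
    ∀ n : ℤ, HasSum (fun m : ℤ => gauss η m * ((opY η ^ m) f).coeff n) (g.coeff n)

end

end EllipticMacdonald

namespace EllipticMacdonald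

/-! ### Dilations and divided differences -/

/-! Both operators are diagonalised on one explicit family. With n = j + 2, put S_n = (x^n - x⁻ⁿ)/(x
- x⁻¹) and R_n = (S_n(qx) - S_n(q⁻¹x))/(x - x⁻¹); these are `cheb n` and `rodrigues q n`. Multiplied
by `weight q`, R_n becomes a combination of x^{±(n+1)} and x^{±(n-1)} only (`weight_mul_rodrigues`).
Hence R_n is orthogonal to all symmetric polynomials of degree below j, and its monic multiple is
P_j.

Completing the square gives ∑ q^{m²/2} Γ^m = θ₀(1) γ, where γ is the Gaussian operator x^n ↦
q^{-n²/2} x^n. The m-th coefficient of T(q) involves only q^{2m}, 1 and q^{-2m}, so T(q) is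
θ₀(1)/weight times a three-term operator `opNum` after γ (`hasSum_opTTerm`). Moving γ through the
two divisions by x - x⁻¹ in R_n gives `opNum_gaussOp_rodrigues`. The eigenvalue is then q^{-n²/2}
θ₀(1) = θ₀(q^n).

On symmetric polynomials Y + Y⁻¹ is Macdonald's operator, and R_n is an eigenvector with eigenvalue
q^n + q⁻ⁿ (`opY_add_symm_rodrigues`). So R_n is a sum of Y-eigenvectors with eigenvalues q^{±n}.
Since θ₀(q^n) = θ₀(q⁻ⁿ), the operator θ₀(Y) multiplies R_n by the same θ₀(q^n). The P_j span the
symmetric polynomials, and linearity finishes the proof. -/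

@[simp] theorem dilate_T (c : ℂ) (n : ℤ) : dilate c (T n) = C (c ^ n) * T n := by
  rw [dilate, onMonomials_T, smul_eq_C_mul]

theorem linearMap_C_mul (A : ℂ[T;T⁻¹] →ₗ[ℂ] ℂ[T;T⁻¹]) (a : ℂ) (f : ℂ[T;T⁻¹]) :
    A (C a * f) = C a * A f := by
  rw [← smul_eq_C_mul, map_smul, smul_eq_C_mul]

theorem dilate_T_mul {c : ℂ} (hc : c ≠ 0) (k : ℤ) (f : ℂ[T;T⁻¹]) :
    dilate c (T k * f) = C (c ^ k) * T k * dilate c f := by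
  induction f using LaurentPolynomial.induction_on' with
  | add p r hp hr => rw [mul_add, map_add, map_add, hp, hr, mul_add]
  | C_mul_T n a =>
    rw [mul_left_comm, ← T_add, linearMap_C_mul, linearMap_C_mul, dilate_T, dilate_T, zpow_add₀ hc,
      T_add, map_mul]
    ring

theorem dilate_dilate (c d : ℂ) (f : ℂ[T;T⁻¹]) : dilate c (dilate d f) = dilate (c * d) f := by
  induction f using LaurentPolynomial.induction_on' with
  | add p r hp hr => simp only [map_add, hp, hr]
  | C_mul_T n a =>
    simp only [linearMap_C_mul, dilate_T, mul_zpow, map_mul]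
    ring

theorem dilate_one (f : ℂ[T;T⁻¹]) : dilate 1 f = f := by
  induction f using LaurentPolynomial.induction_on' with
  | add p r hp hr => rw [map_add, hp, hr]
  | C_mul_T n a => rw [linearMap_C_mul, dilate_T, one_zpow, map_one, one_mul]

theorem invert_dilate (c : ℂ) (f : ℂ[T;T⁻¹]) :
    invert (dilate c f) = dilate c⁻¹ (invert f) := by
  induction f using LaurentPolynomial.induction_on' with
  | add p r hp hr => simp only [map_add, hp, hr]
  | C_mul_T n a =>
    simp only [linearMap_C_mul, dilate_T, map_mul, invert_C, invert_T, inv_zpow', neg_neg]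

theorem coeff_dilate (c : ℂ) (f : ℂ[T;T⁻¹]) (n : ℤ) :
    (dilate c f).coeff n = c ^ n * f.coeff n := by
  induction f using LaurentPolynomial.induction_on' with
  | add p r hp hr =>
    simp only [map_add, AddMonoidAlgebra.coeff_add, Finsupp.add_apply, hp, hr, mul_add]
  | C_mul_T k a =>
    rw [linearMap_C_mul, dilate_T, ← smul_eq_C_mul, ← smul_eq_C_mul, ← smul_eq_C_mul]
    simp only [AddMonoidAlgebra.coeff_smul, Finsupp.smul_apply, T_apply, smul_eq_mul]
    split_ifs with h
    · subst h; ring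
    · simp

theorem coeff_T_mul (k n : ℤ) (f : ℂ[T;T⁻¹]) : (T k * f).coeff n = f.coeff (n - k) := by
  rw [T, AddMonoidAlgebra.coeff_single_mul_eq_mul_coeff (n - k), one_mul]
  intro a _
  omega

theorem coeff_C_mul (a : ℂ) (n : ℤ) (f : ℂ[T;T⁻¹]) : (C a * f).coeff n = a * f.coeff n := by
  rw [← smul_eq_C_mul]; rfl

theorem T_mul_T_neg (k : ℤ) : (T k * T (-k) : ℂ[T;T⁻¹]) = 1 := by
  rw [← T_add, add_neg_cancel, T_zero]

theorem T_one_sub_ne_zero : (T 1 - T (-1) : ℂ[T;T⁻¹]) ≠ 0 := by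
  intro h
  have := congrArg (fun f : ℂ[T;T⁻¹] => f.coeff 1) h
  simp at this

/-- The divided difference `f(x) ↦ (f(x) - f(x⁻¹)) / (x - x⁻¹)`. -/
noncomputable def symDiff (f : ℂ[T;T⁻¹]) : ℂ[T;T⁻¹] := -(T 1 * divDiff f)

theorem symDiff_spec (f : ℂ[T;T⁻¹]) :
    (T 1 - T (-1)) * symDiff f = f - invert f := by
  rw [← divDiff_spec, symDiff, show (2 : ℤ) = 1 + 1 by norm_num, T_add]
  linear_combination divDiff f * T_mul_T_neg 1

theorem invert_symDiff (f : ℂ[T;T⁻¹]) : invert (symDiff f) = symDiff f := by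
  apply mul_left_cancel₀ T_one_sub_ne_zero
  have h := congrArg (invert : ℂ[T;T⁻¹] ≃ₐ[ℂ] ℂ[T;T⁻¹]) (symDiff_spec f)
  have hi : invert (invert f) = f := involutive_invert f
  simp only [map_mul, map_sub, invert_T, neg_neg, hi] at h
  linear_combination -h - symDiff_spec f

/-- Division by `x - x⁻¹` lowers the degree by one and keeps the leading coefficient. -/
theorem coeff_of_mul_eq {g h : ℂ[T;T⁻¹]} (hg : (T 1 - T (-1)) * g = h) {d : ℤ}
    (hd : ∀ n, d < n → h.coeff n = 0) :
    (∀ n, d ≤ n → g.coeff n = 0) ∧ g.coeff (d - 1) = h.coeff d := by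
  have hrec : ∀ n, g.coeff (n - 1) - g.coeff (n + 1) = h.coeff n := fun n => by
    rw [← hg, sub_mul, AddMonoidAlgebra.coeff_sub, Finsupp.sub_apply, coeff_T_mul, coeff_T_mul,
      sub_neg_eq_add]
  obtain ⟨B, hB⟩ : ∃ B : ℤ, ∀ n, B < n → g.coeff n = 0 := by
    obtain ⟨B, hB⟩ := g.coeff.support.bddAbove
    exact ⟨B, fun n hn => by
      by_contra hne
      exact absurd (hB (Finset.mem_coe.2 (Finsupp.mem_support_iff.2 hne))) (not_le.2 hn)⟩
  -- Descent from the bound `B` of the support: `hrec` at n + 1 gives g_n = g_{n+2} once n ≥ d, so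
  -- the induction on `k` goes in steps of two.
  have hz : ∀ (k : ℕ) (n : ℤ), d ≤ n → B < n + k → g.coeff n = 0 := by
    intro k
    induction k using Nat.strong_induction_on with
    | _ k ih =>
      intro n hn hk
      rcases le_or_gt k 1 with h1 | h1
      · rcases lt_or_ge B n with h2 | h2
        · exact hB n h2
        · have := hrec (n + 1)
          rw [hd _ (by omega), hB (n + 1 + 1) (by omega)] at this
          simpa using this
      · have := hrec (n + 1)
        rw [hd _ (by omega), ih (k - 2) (by omega) (n + 1 + 1) (by omega) (by omega)] at this
        simpa using this
  have hz' : ∀ n, d ≤ n → g.coeff n = 0 := fun n hn =>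
    hz (B - n + 1).toNat n hn (by omega)
  refine ⟨hz', ?_⟩
  rw [← hrec d, hz' (d + 1) (by omega), sub_zero]

/-! ### Macdonald polynomials by the Rodrigues formula -/

/-- The Chebyshev polynomial `(x^n - x^{-n}) / (x - x⁻¹)`. -/
noncomputable def cheb (n : ℤ) : ℂ[T;T⁻¹] := symDiff (T n)

/-- The multiple of the Macdonald polynomial of degree `n - 2` given by the Rodrigues formula. -/
noncomputable def rodrigues (q : ℂ) (n : ℤ) : ℂ[T;T⁻¹] := symDiff (dilate q (cheb n))

/-- `(qx - q⁻¹x⁻¹)(x - x⁻¹)(q⁻¹x - qx⁻¹)`. -/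
noncomputable def weight (q : ℂ) : ℂ[T;T⁻¹] :=
  (C q * T 1 - C q⁻¹ * T (-1)) * (T 1 - T (-1)) * (C q⁻¹ * T 1 - C q * T (-1))

theorem cheb_spec (n : ℤ) : (T 1 - T (-1)) * cheb n = T n - T (-n) := by
  rw [cheb, symDiff_spec, invert_T]

theorem rodrigues_spec (q : ℂ) (n : ℤ) :
    (T 1 - T (-1)) * rodrigues q n = dilate q (cheb n) - dilate q⁻¹ (cheb n) := by
  rw [rodrigues, symDiff_spec, invert_dilate, cheb, invert_symDiff]

theorem dilate_cheb {q : ℂ} (hq : q ≠ 0) (n : ℤ) :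
    (C q * T 1 - C q⁻¹ * T (-1)) * dilate q (cheb n) = C (q ^ n) * T n - C (q ^ (-n)) * T (-n) := by
  have h := congrArg (dilate q) (cheb_spec n)
  rw [sub_mul, map_sub, map_sub, dilate_T_mul hq, dilate_T_mul hq, dilate_T, dilate_T, ← sub_mul,
    zpow_one, zpow_neg_one] at h
  exact h

/-- The three factors of `weight` clear the denominators of the two shifted Chebyshev polynomials
and of the outer division. Only the exponents ±(n+1) and ±(n-1) survive. -/
theorem weight_mul_rodrigues {q : ℂ} (hq : q ≠ 0) (n : ℤ) :
    weight q * rodrigues q n =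
      C (q ^ (n - 1) - q ^ (-(n - 1))) * (T (n + 1) - T (-(n + 1))) -
        C (q ^ (n + 1) - q ^ (-(n + 1))) * (T (n - 1) - T (-(n - 1))) := by
  have h1 := dilate_cheb hq n
  have h2 := dilate_cheb (inv_ne_zero hq) n
  have h3 := rodrigues_spec q n
  rw [inv_inv] at h2
  have e : weight q * rodrigues q n =
      (C q⁻¹ * T 1 - C q * T (-1)) * (C (q ^ n) * T n - C (q ^ (-n)) * T (-n)) -
      (C q * T 1 - C q⁻¹ * T (-1)) * (C (q⁻¹ ^ n) * T n - C (q⁻¹ ^ (-n)) * T (-n)) := by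
    rw [weight]
    linear_combination (C q * T 1 - C q⁻¹ * T (-1)) * (C q⁻¹ * T 1 - C q * T (-1)) * h3 +
      (C q⁻¹ * T 1 - C q * T (-1)) * h1 - (C q * T 1 - C q⁻¹ * T (-1)) * h2
  rw [e]
  simp only [neg_add, neg_neg, sub_eq_add_neg, T_add, zpow_add₀ hq, inv_zpow', map_add,
    map_mul, map_neg, zpow_one, zpow_neg_one]
  ring

theorem invert_rodrigues (q : ℂ) (n : ℤ) : invert (rodrigues q n) = rodrigues q n :=
  invert_symDiff _

theorem coeff_rodrigues (q : ℂ) (j : ℕ) :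
    (∀ n : ℤ, (j : ℤ) < n → (rodrigues q (j + 2)).coeff n = 0) ∧
      (rodrigues q (j + 2)).coeff j = q ^ (j + 1 : ℤ) - q ^ (-(j + 1) : ℤ) := by
  -- Each of the two divisions lowers the degree by one, from j + 2 to j; the factor q^{j+1} -
  -- q^{-(j+1)} arises between them, in degree j + 1.
  have h1 := coeff_of_mul_eq (cheb_spec (j + 2)) (d := j + 2) (fun n hn => by
    simp only [AddMonoidAlgebra.coeff_sub, Finsupp.sub_apply, T_apply]
    rw [if_neg (by omega), if_neg (by omega), sub_zero])
  have h2 := coeff_of_mul_eq (rodrigues_spec q (j + 2)) (d := j + 1) (fun n hn => by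
    simp only [AddMonoidAlgebra.coeff_sub, Finsupp.sub_apply, coeff_dilate]
    rw [h1.1 n (by omega)]; simp)
  refine ⟨fun n hn => h2.1 n (by omega), ?_⟩
  have h3 := h1.2
  rw [show (j + 2 - 1 : ℤ) = j + 1 by ring] at h3
  rw [show (j + 1 - 1 : ℤ) = j by ring] at h2
  rw [h2.2]
  simp only [AddMonoidAlgebra.coeff_sub, Finsupp.sub_apply, coeff_dilate, h3]
  simp only [T_apply, inv_zpow']
  rw [if_pos trivial, if_neg (by omega), sub_zero, mul_one, mul_one]

/-! ### The Gaussian operator -/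

theorem gauss_ne_zero (η : ℂ) (m : ℤ) : gauss η m ≠ 0 := exp_ne_zero _

theorem qPar_zpow (η : ℂ) (n : ℤ) : qPar η ^ n = exp (n * (-2 * Real.pi * I * η)) := by
  rw [qPar, exp_int_mul]

theorem gauss_add (η : ℂ) (m k : ℤ) :
    gauss η (m + k) = gauss η m * gauss η k * qPar η ^ (m * k) := by
  rw [qPar_zpow, gauss, gauss, gauss, ← exp_add, ← exp_add]
  congr 1
  push_cast
  ring

theorem gauss_neg (η : ℂ) (m : ℤ) : gauss η (-m) = gauss η m := by
  simp [gauss]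

theorem gauss_one_sq (η : ℂ) : gauss η 1 * gauss η 1 = qPar η := by
  rw [gauss, qPar, ← exp_add]; congr 1; push_cast; ring

/-- The Gaussian operator `x^n ↦ q^{-n²/2} x^n`. -/
noncomputable def gaussOp (η : ℂ) : ℂ[T;T⁻¹] →ₗ[ℂ] ℂ[T;T⁻¹] :=
  onMonomials fun n => (gauss η n)⁻¹ • T n

theorem gaussOp_T (η : ℂ) (n : ℤ) : gaussOp η (T n) = C (gauss η n)⁻¹ * T n := by
  rw [gaussOp, onMonomials_T, smul_eq_C_mul]

theorem gaussOp_T_mul (η : ℂ) (k : ℤ) (f : ℂ[T;T⁻¹]) :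
    gaussOp η (T k * f) = C (gauss η k)⁻¹ * T k * dilate (qPar η ^ (-k)) (gaussOp η f) := by
  induction f using LaurentPolynomial.induction_on' with
  | add p r hp hr => simp only [mul_add, map_add, hp, hr]
  | C_mul_T n a =>
    have h : gaussOp η (T k * T n) =
        C ((gauss η k)⁻¹ * (gauss η n)⁻¹ * (qPar η ^ (-k)) ^ n) * (T k * T n) := by
      rw [← T_add, gaussOp_T, gauss_add, mul_inv, mul_inv, ← zpow_mul, neg_mul, zpow_neg]
    rw [mul_left_comm, linearMap_C_mul, h]
    simp only [linearMap_C_mul, gaussOp_T, dilate_T, map_mul]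
    ring

theorem gaussOp_dilate (η c : ℂ) (f : ℂ[T;T⁻¹]) :
    gaussOp η (dilate c f) = dilate c (gaussOp η f) := by
  induction f using LaurentPolynomial.induction_on' with
  | add p r hp hr => simp only [map_add, hp, hr]
  | C_mul_T n a =>
    simp only [linearMap_C_mul, gaussOp_T, dilate_T]
    ring

/-- The numerator of the operator `T(q)`, up to the Gaussian operator and a scalar. -/
noncomputable def opNum (q : ℂ) : ℂ[T;T⁻¹] → ℂ[T;T⁻¹] := fun f =>
  (T 3 - C (q⁻¹ ^ 2) * T 1) * (C (q⁻¹ ^ 2) * dilate (q⁻¹ ^ 2) f) -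
    C (q⁻¹ ^ 2 + 1) * (T 1 - T (-1)) * f +
    (C (q⁻¹ ^ 2) * T (-1) - T (-3)) * (C (q⁻¹ ^ 2) * dilate (q ^ 2) f)

/-- A factorisation of `opNum` through the differences produced by conjugating multiplication by x -
x⁻¹ with the Gaussian operator. Here `G₁`, `G₂` stand for G(q⁻²x), G(q²x). -/
theorem opNum_identity {K : Type*} [CommRing K] {Q R X Z : K} (hQ : Q * R = 1) (hX : X * Z = 1)
    (G G₁ G₂ : K) :
    (X * X * X - R ^ 2 * X) * (R ^ 2 * G₁) - (R ^ 2 + 1) * (X - Z) * G +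
        (R ^ 2 * Z - Z * Z * Z) * (R ^ 2 * G₂) =
      R * ((Q * X - R * Z) * (R * X) * (R * X * G₁ - Q * Z * G) -
        (R * X - Q * Z) * (R * Z) * (Q * X * G - R * Z * G₂)) := by
  grind

theorem opNum_gaussOp_rodrigues (η : ℂ) (n : ℤ) :
    opNum (qPar η) (gaussOp η (rodrigues (qPar η) n)) =
      C (gauss η n)⁻¹ * (weight (qPar η) * rodrigues (qPar η) n) := by
  set q := qPar η with hq
  have hq0 : q ≠ 0 := qPar_ne_zero η
  set f := cheb n with hf
  set g := rodrigues q n with hg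
  set s : ℂ := (gauss η 1)⁻¹ with hs
  have hss : (C s * C s : ℂ[T;T⁻¹]) = C q⁻¹ := by
    rw [← map_mul, hs, ← mul_inv, gauss_one_sq]
  have hQ : (C q * C q⁻¹ : ℂ[T;T⁻¹]) = 1 := by rw [← map_mul, mul_inv_cancel₀ hq0, map_one]
  have hX : (T 1 * T (-1) : ℂ[T;T⁻¹]) = 1 := T_mul_T_neg 1
  -- Conjugation by γ turns multiplication by x into q^{-1/2} x Γ⁻¹; the scalar `s` is q^{-1/2}.
  have key : ∀ h : ℂ[T;T⁻¹], gaussOp η ((T 1 - T (-1)) * h) =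
      C s * (T 1 * dilate q⁻¹ (gaussOp η h) - T (-1) * dilate q (gaussOp η h)) := fun h => by
    rw [sub_mul, map_sub, gaussOp_T_mul, gaussOp_T_mul, gauss_neg, neg_neg, zpow_one, zpow_neg_one]
    ring
  have h1 := congrArg (gaussOp η) (cheb_spec n)
  rw [key, map_sub, gaussOp_T, gaussOp_T, gauss_neg, ← mul_sub, ← cheb_spec n, ← hf] at h1
  have h2 := congrArg (gaussOp η) (rodrigues_spec q n)
  rw [key, map_sub, gaussOp_dilate, gaussOp_dilate, ← hf, ← hg] at h2
  set F := gaussOp η f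
  set G := gaussOp η g
  have dil : ∀ (c d : ℂ) (h : ℂ[T;T⁻¹]), c * d = 1 → dilate c (dilate d h) = h := fun c d h e => by
    rw [dilate_dilate, e, dilate_one]
  have a1 := congrArg (dilate q) h1
  have b1 := congrArg (dilate q⁻¹) h1
  have a2 := congrArg (dilate q) h2
  have b2 := congrArg (dilate q⁻¹) h2
  have hi : q⁻¹ ≠ 0 := inv_ne_zero hq0
  simp only [linearMap_C_mul, map_sub, sub_mul, dilate_T_mul hq0, dilate_T_mul hi,
    dil _ _ _ (mul_inv_cancel₀ hq0), dil _ _ _ (inv_mul_cancel₀ hq0), dilate_dilate, ← pow_two,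
    zpow_one, zpow_neg_one, inv_inv] at a1 b1 a2 b2
  have hr := rodrigues_spec q n
  rw [← hf, ← hg] at hr
  have e3 : (T 3 : ℂ[T;T⁻¹]) = T 1 * T 1 * T 1 := by rw [← T_add, ← T_add]; rfl
  have e3' : (T (-3) : ℂ[T;T⁻¹]) = T (-1) * T (-1) * T (-1) := by rw [← T_add, ← T_add]; rfl
  rw [opNum, weight, e3, e3', map_pow, map_add, map_pow, map_one]
  generalize C (gauss η n)⁻¹ = κ at *
  generalize (C q : ℂ[T;T⁻¹]) = Q at *
  generalize (C q⁻¹ : ℂ[T;T⁻¹]) = R at *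
  generalize (C s : ℂ[T;T⁻¹]) = S at *
  generalize (T 1 : ℂ[T;T⁻¹]) = X at *
  generalize (T (-1) : ℂ[T;T⁻¹]) = Z at *
  generalize dilate (q ^ 2) F = F2 at *
  generalize dilate (q⁻¹ ^ 2) F = F2' at *
  generalize dilate (q ^ 2) G = G2 at *
  generalize dilate (q⁻¹ ^ 2) G = G2' at *
  generalize dilate q f = f1 at *
  generalize dilate q⁻¹ f = f1' at *
  -- `hr`, `a1` and `b1` express the left side through F(x) and F(q^{±2}x). These occur only in the
  -- differences F(q²x) - F(x) and F(x) - F(q⁻²x), which `a2` and `b2` rewrite in terms of G.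
  have e : κ * ((Q * X - R * Z) * (X - Z) * (R * X - Q * Z) * g) =
      S * S * ((Q * X - R * Z) * (R * X) * (R * X * G2' - Q * Z * G) -
        (R * X - Q * Z) * (R * Z) * (Q * X * G - R * Z * G2)) := by
    linear_combination κ * (Q * X - R * Z) * (R * X - Q * Z) * hr - (R * X - Q * Z) * a1 +
      (Q * X - R * Z) * b1 + S * (R * X - Q * Z) * (R * Z) * a2 -
      S * (Q * X - R * Z) * (R * X) * b2
  rw [e, hss]
  exact opNum_identity hQ hX _ _ _

/-! ### Existence and uniqueness of the Macdonald polynomials -/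

theorem norm_qPar_lt_one {η : ℂ} (hη : η.im < 0) : ‖qPar η‖ < 1 := by
  rw [qPar, norm_exp, Real.exp_lt_one_iff]
  simp
  nlinarith [Real.pi_pos]

theorem zpow_sub_zpow_neg_ne_zero {q : ℂ} (hq : q ≠ 0) (hq1 : ‖q‖ < 1) {n : ℤ} (hn : 0 < n) :
    q ^ n - q ^ (-n) ≠ 0 := by
  intro h
  have h1 : ‖q ^ n‖ = ‖q ^ (-n)‖ := by rw [sub_eq_zero.1 h]
  rw [norm_zpow, norm_zpow] at h1
  have := zpow_right_injective₀ (norm_pos_iff.2 hq) hq1.ne h1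
  omega

theorem prod_eq_weight {q : ℂ} (hq : q ≠ 0) :
    (∏ j ∈ Finset.range 2,
      (1 - C (q ^ (2 * j)) * T 2) * (1 - C (q ^ (2 * j)) * T (-2)) : ℂ[T;T⁻¹]) =
      C (q ^ 2) * weight q * (T 1 - T (-1)) := by
  have hQ : (C q * C q⁻¹ : ℂ[T;T⁻¹]) = 1 := by rw [← map_mul, mul_inv_cancel₀ hq, map_one]
  have hX : (T 1 * T (-1) : ℂ[T;T⁻¹]) = 1 := T_mul_T_neg 1
  have e2 : (T 2 : ℂ[T;T⁻¹]) = T 1 * T 1 := by rw [← T_add]; rfl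
  have e2' : (T (-2) : ℂ[T;T⁻¹]) = T (-1) * T (-1) := by rw [← T_add]; rfl
  rw [Finset.prod_range_succ, Finset.prod_range_one, weight, e2, e2', mul_zero, pow_zero, mul_one,
    map_one, map_pow]
  generalize (C q : ℂ[T;T⁻¹]) = Q at *
  generalize (C q⁻¹ : ℂ[T;T⁻¹]) = R at *
  generalize (T 1 : ℂ[T;T⁻¹]) = X at *
  generalize (T (-1) : ℂ[T;T⁻¹]) = Z at *
  clear e2 e2'
  grind

theorem coeff_mul_T (k n : ℤ) (f : ℂ[T;T⁻¹]) : (f * T k).coeff n = f.coeff (n - k) := by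
  rw [mul_comm, coeff_T_mul]

/-- The density times `rodrigues` involves only x^{±(j+4)}, x^{±(j+2)} and x^{±j}. Against `d` of
degree at most j only x^{±j} contributes, and symmetry of `d` gives the factor 2. -/
theorem innerCT_rodrigues {q : ℂ} (hq : q ≠ 0) (j : ℕ) {d : ℂ[T;T⁻¹]} (hd : invert d = d)
    (hdeg : ∀ n : ℤ, (j : ℤ) < n → d.coeff n = 0) :
    innerCT q 2 d (rodrigues q (j + 2)) =
      2 * q ^ 2 * (q ^ (j + 3 : ℤ) - q ^ (-(j + 3) : ℤ)) * d.coeff j := by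
  have hs : ∀ n, d.coeff (-n) = d.coeff n := fun n => by rw [← invert_apply, hd]
  have e : d * rodrigues q (j + 2) * (C (q ^ 2) * weight q * (T 1 - T (-1))) =
      C (q ^ 2 * (q ^ (j + 1 : ℤ) - q ^ (-(j + 1) : ℤ))) *
        (d * T (j + 4) - d * T (-(j + 2)) - d * T (j + 2) + d * T (-(j + 4))) -
      C (q ^ 2 * (q ^ (j + 3 : ℤ) - q ^ (-(j + 3) : ℤ))) *
        (d * T (j + 2) - d * T (-j) - d * T j + d * T (-(j + 2))) := by
    have h := weight_mul_rodrigues hq (j + 2)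
    have t1 : (T (j + 4) : ℂ[T;T⁻¹]) = T 1 * T (j + 2 + 1) := by rw [← T_add]; ring_nf
    have t2 : (T (-(j + 2)) : ℂ[T;T⁻¹]) = T 1 * T (-(j + 2 + 1)) := by rw [← T_add]; ring_nf
    have t3 : (T (j + 2) : ℂ[T;T⁻¹]) = T (-1) * T (j + 2 + 1) := by rw [← T_add]; ring_nf
    have t4 : (T (-(j + 4)) : ℂ[T;T⁻¹]) = T (-1) * T (-(j + 2 + 1)) := by rw [← T_add]; ring_nf
    have t5 : (T (j + 2) : ℂ[T;T⁻¹]) = T 1 * T (j + 2 - 1) := by rw [← T_add]; ring_nf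
    have t6 : (T (-j) : ℂ[T;T⁻¹]) = T 1 * T (-(j + 2 - 1)) := by rw [← T_add]; ring_nf
    have t7 : (T j : ℂ[T;T⁻¹]) = T (-1) * T (j + 2 - 1) := by rw [← T_add]; ring_nf
    have t8 : (T (-(j + 2)) : ℂ[T;T⁻¹]) = T (-1) * T (-(j + 2 - 1)) := by rw [← T_add]; ring_nf
    rw [show (j + 2 - 1 : ℤ) = j + 1 by ring, show (j + 2 + 1 : ℤ) = j + 3 by ring] at *
    rw [map_mul, map_mul]
    linear_combination C (q ^ 2) * d * (T 1 - T (-1)) * h -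
      C (q ^ 2) * C (q ^ (j + 1 : ℤ) - q ^ (-(j + 1) : ℤ)) * d * (t1 - t2 - t3 + t4) +
      C (q ^ 2) * C (q ^ (j + 3 : ℤ) - q ^ (-(j + 3) : ℤ)) * d * (t5 - t6 - t7 + t8)
  rw [innerCT, invert_rodrigues, prod_eq_weight hq, e]
  simp only [AddMonoidAlgebra.coeff_sub, AddMonoidAlgebra.coeff_add, Finsupp.sub_apply,
    Finsupp.add_apply, coeff_C_mul, coeff_mul_T, zero_sub, hs]
  rw [hdeg (j + 4) (by omega), hdeg (j + 2) (by omega)]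
  ring

/-- The monic Macdonald polynomial of degree `j`. -/
noncomputable def macdonald (q : ℂ) (j : ℕ) : ℂ[T;T⁻¹] :=
  C (q ^ (j + 1 : ℤ) - q ^ (-(j + 1) : ℤ))⁻¹ * rodrigues q (j + 2)

theorem innerCT_C_mul (q a : ℂ) (m : ℕ) (P Q : ℂ[T;T⁻¹]) :
    innerCT q m P (C a * Q) = a * innerCT q m P Q := by
  rw [innerCT, innerCT, ← coeff_C_mul, map_mul, invert_C]
  congr 2
  ring

theorem innerCT_sub (q : ℂ) (m : ℕ) (P P' Q : ℂ[T;T⁻¹]) :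
    innerCT q m (P - P') Q = innerCT q m P Q - innerCT q m P' Q := by
  rw [innerCT, sub_mul, sub_mul]; rfl

theorem innerCT_comm (q : ℂ) (m : ℕ) {P Q : ℂ[T;T⁻¹]} (hP : invert P = P) (hQ : invert Q = Q) :
    innerCT q m P Q = innerCT q m Q P := by
  rw [innerCT, innerCT, hP, hQ, mul_comm P Q]

theorem invert_macdonald (q : ℂ) (j : ℕ) : invert (macdonald q j) = macdonald q j := by
  rw [macdonald, map_mul, invert_C, invert_rodrigues]

theorem coeff_macdonald_of_lt (q : ℂ) {j : ℕ} {n : ℤ} (hn : (j : ℤ) < n) :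
    (macdonald q j).coeff n = 0 := by
  rw [macdonald, coeff_C_mul, (coeff_rodrigues q j).1 n hn, mul_zero]

theorem coeff_macdonald_self {q : ℂ} (hq : q ≠ 0) (hq1 : ‖q‖ < 1) (j : ℕ) :
    (macdonald q j).coeff j = 1 := by
  rw [macdonald, coeff_C_mul, (coeff_rodrigues q j).2, inv_mul_cancel₀]
  exact zpow_sub_zpow_neg_ne_zero hq hq1 (by omega)

theorem innerCT_macdonald {q : ℂ} (hq : q ≠ 0) (j : ℕ) {d : ℂ[T;T⁻¹]} (hd : invert d = d)
    (hdeg : ∀ n : ℤ, (j : ℤ) < n → d.coeff n = 0) :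
    innerCT q 2 d (macdonald q j) =
      (q ^ (j + 1 : ℤ) - q ^ (-(j + 1) : ℤ))⁻¹ *
        (2 * q ^ 2 * (q ^ (j + 3 : ℤ) - q ^ (-(j + 3) : ℤ)) * d.coeff j) := by
  rw [macdonald, innerCT_C_mul, innerCT_rodrigues hq j hd hdeg]

theorem innerCT_macdonald_of_lt {q : ℂ} (hq : q ≠ 0) {j k : ℕ} (h : j < k) :
    innerCT q 2 (macdonald q j) (macdonald q k) = 0 := by
  rw [innerCT_macdonald hq k (invert_macdonald q j) fun n hn => coeff_macdonald_of_lt q (by omega),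
    coeff_macdonald_of_lt q (by omega), mul_zero, mul_zero]

theorem isMacdonald_macdonald {q : ℂ} (hq : q ≠ 0) (hq1 : ‖q‖ < 1) :
    IsMacdonald q 2 (macdonald q) where
  leading := coeff_macdonald_self hq hq1
  lower _ _ := coeff_macdonald_of_lt q
  symmetric := invert_macdonald q
  orthogonal j k h := by
    rcases lt_or_gt_of_ne h with h | h
    · exact innerCT_macdonald_of_lt hq h
    · rw [innerCT_comm q 2 (invert_macdonald q j) (invert_macdonald q k)]
      exact innerCT_macdonald_of_lt hq h

theorem IsMacdonald.eq_macdonald {q : ℂ} (hq : q ≠ 0) (hq1 : ‖q‖ < 1) {P : ℕ → ℂ[T;T⁻¹]}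
    (hP : IsMacdonald q 2 P) : P = macdonald q := by
  funext j
  have hM := isMacdonald_macdonald hq hq1
  induction j using Nat.strong_induction_on with
  | _ j ih =>
    have hsym : invert (P j - macdonald q j) = P j - macdonald q j := by
      rw [map_sub, hP.symmetric, hM.symmetric]
    -- Downward induction on the exponent, `t` being the distance from j; both families are monic,
    -- which settles t = 0.
    have hz : ∀ (t : ℕ) (n : ℤ), (j : ℤ) - t ≤ n → 0 ≤ n →
        (P j - macdonald q j).coeff n = 0 := by
      intro t
      induction t with
      | zero =>
        intro n hn _
        rw [AddMonoidAlgebra.coeff_sub, Finsupp.sub_apply]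
        rcases eq_or_lt_of_le (show (j : ℤ) ≤ n by omega) with rfl | h
        · rw [hP.leading, hM.leading, sub_self]
        · rw [hP.lower j n h, hM.lower j n h, sub_self]
      | succ t iht =>
        intro n hn h0
        by_cases hc : (j : ℤ) - t ≤ n
        · exact iht n hc h0
        · lift n to ℕ using h0
          -- The difference already has degree at most n, so pairing it with `macdonald q n`
          -- isolates its n-th coefficient. The pairing is 0 because `P n = macdonald q n` for n <
          -- j.
          have h := innerCT_macdonald hq n hsym fun m hm => iht m (by omega) (by omega)
          rw [innerCT_sub, hM.orthogonal j n (by omega), ← ih n (by omega),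
            hP.orthogonal j n (by omega), sub_self] at h
          have h1 := zpow_sub_zpow_neg_ne_zero hq hq1 (show (0 : ℤ) < n + 1 by omega)
          have h3 := zpow_sub_zpow_neg_ne_zero hq hq1 (show (0 : ℤ) < n + 3 by omega)
          have h4 := (mul_eq_zero.1 h.symm).resolve_left (inv_ne_zero h1)
          exact (mul_eq_zero.1 h4).resolve_left
            (mul_ne_zero (mul_ne_zero two_ne_zero (pow_ne_zero 2 hq)) h3)
    rw [← sub_eq_zero]
    refine LaurentPolynomial.ext fun n => ?_
    rcases le_total 0 n with h | h
    · exact hz j n (by omega) h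
    · rw [← hsym, invert_apply]
      exact hz j (-n) (by omega) (by omega)

/-! ### The Cherednik operator on symmetric polynomials -/

theorem divDiff_of_symmetric {f : ℂ[T;T⁻¹]} (hf : invert f = f) : divDiff f = 0 := by
  apply mul_left_cancel₀ one_sub_T_ne
  rw [divDiff_spec, hf, sub_self, mul_zero]

/-- Y⁻¹ is Γ⁻¹ after the inverse Hecke operator, and the latter is the scalar q⁻² on symmetric
polynomials. -/
theorem opY_symm_of_symmetric (η : ℂ) {f : ℂ[T;T⁻¹]} (hf : invert f = f) :
    (opY η).symm f = C ((qPar η)⁻¹ ^ 2) * dilate (qPar η)⁻¹ f := by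
  have h : (opY η).symm f = dilate (qPar η)⁻¹ (hecke (qPar η ^ 2)⁻¹ f) := rfl
  rw [h, hecke, LinearMap.add_apply, LinearMap.smul_apply, LinearMap.smul_apply,
    divDiff_of_symmetric hf, smul_zero, add_zero, map_smul, smul_eq_C_mul, inv_pow]
  rfl

theorem one_sub_mul_opY_of_symmetric (η : ℂ) {f : ℂ[T;T⁻¹]} (hf : invert f = f) :
    (1 - T 2) * opY η f =
      (C ((qPar η)⁻¹ ^ 2) - C (qPar η ^ 2) * T 2) * dilate (qPar η) f +
        C (qPar η ^ 2 - (qPar η)⁻¹ ^ 2) * dilate (qPar η)⁻¹ f := by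
  have h : opW η f = invert (dilate (qPar η) f) := rfl
  rw [opY_spec, h, invert_dilate, hf]
  rfl

theorem mul_T_one_sub_ne_zero {a b : ℂ} (ha : a ≠ 0) :
    (C a * T 1 - C b * T (-1) : ℂ[T;T⁻¹]) ≠ 0 := by
  intro h
  have := congrArg (fun f : ℂ[T;T⁻¹] => f.coeff 1) h
  simp [coeff_C_mul, -C_apply] at this
  exact ha this

theorem weight_ne_zero {q : ℂ} (hq : q ≠ 0) : weight q ≠ 0 :=
  mul_ne_zero (mul_ne_zero (mul_T_one_sub_ne_zero hq) T_one_sub_ne_zero)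
    (mul_T_one_sub_ne_zero (inv_ne_zero hq))

theorem dilate_weight_mul {c : ℂ} (hc : c ≠ 0) (q : ℂ) (f : ℂ[T;T⁻¹]) :
    dilate c (weight q * f) =
      (C q * (C c * T 1) - C q⁻¹ * (C c⁻¹ * T (-1))) * (C c * T 1 - C c⁻¹ * T (-1)) *
        (C q⁻¹ * (C c * T 1) - C q * (C c⁻¹ * T (-1))) * dilate c f := by
  simp only [weight, sub_mul, mul_sub, mul_assoc, map_sub, linearMap_C_mul, dilate_T_mul hc,
    zpow_one, zpow_neg_one]

/-- The eigenvalue equation of Macdonald's operator after clearing denominators, with `a`, `b`, `Y`,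
`W` standing for q^n, q⁻ⁿ, x^n, x⁻ⁿ. -/
theorem macdonaldOp_identity {K : Type*} [CommRing K] {Q R X Z : K} (hQ : Q * R = 1)
    {a b : K} (hab : a * b = 1) (Y W : K) :
    (R * X - Q * Z) *
        ((X - Z) * (a * a * Y - b * b * W) - (Q * Q * X - R * R * Z) * (Y - W)) +
      (Q * X - R * Z) *
        ((R * R * X - Q * Q * Z) * (Y - W) - (X - Z) * (b * b * Y - a * a * W)) =
      (X - Z) * (a + b) *
        ((R * X - Q * Z) * (a * Y - b * W) - (Q * X - R * Z) * (b * Y - a * W)) := by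
  grind

theorem weight_mul_rodrigues' {q : ℂ} (hq : q ≠ 0) (n : ℤ) :
    weight q * rodrigues q n =
      (C q⁻¹ * T 1 - C q * T (-1)) * (C (q ^ n) * T n - C (q ^ (-n)) * T (-n)) -
      (C q * T 1 - C q⁻¹ * T (-1)) * (C (q ^ (-n)) * T n - C (q ^ n) * T (-n)) := by
  rw [weight_mul_rodrigues hq]
  simp only [neg_add, neg_neg, sub_eq_add_neg, T_add, zpow_add₀ hq, map_add, map_mul, map_neg,
    zpow_one, zpow_neg_one]
  ring

theorem opY_add_symm_rodrigues (η : ℂ) (n : ℤ) :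
    opY η (rodrigues (qPar η) n) + (opY η).symm (rodrigues (qPar η) n) =
      C (qPar η ^ n + qPar η ^ (-n)) * rodrigues (qPar η) n := by
  have hsym := invert_rodrigues (qPar η) n
  have hy := one_sub_mul_opY_of_symmetric η hsym
  have hys := opY_symm_of_symmetric η hsym
  have hq : qPar η ≠ 0 := qPar_ne_zero η
  have hne : (1 - T 2) * weight (qPar η) ≠ 0 := mul_ne_zero one_sub_T_ne (weight_ne_zero hq)
  apply mul_left_cancel₀ hne
  generalize qPar η = q at *
  have h0 := weight_mul_rodrigues' hq n
  have hp := congrArg (dilate q) h0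
  have hm := congrArg (dilate q⁻¹) h0
  rw [dilate_weight_mul hq] at hp
  rw [dilate_weight_mul (inv_ne_zero hq)] at hm
  have hQ : (C q * C q⁻¹ : ℂ[T;T⁻¹]) = 1 := by rw [← map_mul, mul_inv_cancel₀ hq, map_one]
  have hX : (T 1 * T (-1) : ℂ[T;T⁻¹]) = 1 := T_mul_T_neg 1
  have hab : (C (q ^ n) * C (q ^ (-n)) : ℂ[T;T⁻¹]) = 1 := by
    rw [← map_mul, zpow_neg, mul_inv_cancel₀ (zpow_ne_zero n hq), map_one]
  have e2 : (T 2 : ℂ[T;T⁻¹]) = T 1 * T 1 := by rw [← T_add]; rfl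
  simp only [sub_mul (_ * _), mul_sub, mul_assoc, map_sub, linearMap_C_mul, dilate_T_mul hq,
    dilate_T_mul (inv_ne_zero hq), zpow_one, zpow_neg_one, inv_inv, dilate_T, inv_zpow',
    neg_neg] at hp hm
  have key := macdonaldOp_identity hQ (X := T 1) (Z := T (-1)) hab (T n) (T (-n))
  rw [hys, mul_add, weight] at *
  rw [e2, map_sub, map_pow, map_pow] at hy
  rw [e2, map_pow, map_add]
  generalize rodrigues q n = f at *
  generalize opY η f = y at *
  generalize (C q : ℂ[T;T⁻¹]) = Q at *
  generalize (C q⁻¹ : ℂ[T;T⁻¹]) = R at *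
  generalize (T 1 : ℂ[T;T⁻¹]) = X at *
  generalize (T (-1) : ℂ[T;T⁻¹]) = Z at *
  generalize dilate q f = u at *
  generalize dilate q⁻¹ f = v at *
  generalize (C (q ^ n) : ℂ[T;T⁻¹]) = a at *
  generalize (C (q ^ (-n)) : ℂ[T;T⁻¹]) = b at *
  generalize (T n : ℂ[T;T⁻¹]) = Y at *
  generalize (T (-n) : ℂ[T;T⁻¹]) = W at *
  have hp' : (Q * Q * X - R * R * Z) * (Q * X - R * Z) * (X - Z) * u =
      (X - Z) * (a * a * Y - b * b * W) - (Q * Q * X - R * R * Z) * (Y - W) := by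
    clear key h0 hm hy hne hX
    grind
  have hm' : (R * R * X - Q * Q * Z) * (R * X - Q * Z) * (X - Z) * v =
      (R * R * X - Q * Q * Z) * (Y - W) - (X - Z) * (b * b * Y - a * a * W) := by
    clear key h0 hp hy hne hX hp'
    grind
  linear_combination (Q * X - R * Z) * (X - Z) * (R * X - Q * Z) * hy -
    X * (R * X - Q * Z) * hp' - X * (Q * X - R * Z) * hm' - X * key - (1 - X * X) * (a + b) * h0 +
    (((R * X - Q * Z) * (a * Y - b * W) - (Q * X - R * Z) * (b * Y - a * W)) * (a + b) -
      (Q * X - R * Z) * (X - Z) * (R * X - Q * Z) * (R ^ 2 * u + Q ^ 2 * v)) * hX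

/-! ### The theta series -/

theorem summable_theta {η : ℂ} (hη : η.im < 0) {x : ℂ} (hx : x ≠ 0) :
    Summable fun m : ℤ => x ^ m * gauss η m := by
  have h := (summable_jacobiTheta₂_term_iff (log x / (2 * Real.pi * I)) (-η)).2 (by simpa using hη)
  -- This is the Jacobi theta series with τ = -η, in the upper half-plane, and x = e^{2πiz}.
  refine h.congr fun m => ?_
  have h2 : (2 * Real.pi * I : ℂ) ≠ 0 := two_pi_I_ne_zero
  rw [jacobiTheta₂_term, exp_add]
  congr 1
  · rw [mul_right_comm, mul_div_cancel₀ _ h2, mul_comm, exp_int_mul, exp_log hx]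
  · rw [gauss]; congr 1; ring

theorem thetaZero_inv (η x : ℂ) : thetaZero η x⁻¹ = thetaZero η x := by
  rw [thetaZero, ← (Equiv.neg ℤ).tsum_eq]
  simp [thetaZero, gauss_neg]

/-- Completing the square: km + m²/2 = (m + k)²/2 - k²/2. -/
theorem hasSum_theta_qPar {η : ℂ} (hη : η.im < 0) (k : ℤ) :
    HasSum (fun m : ℤ => (qPar η ^ k) ^ m * gauss η m) ((gauss η k)⁻¹ * thetaZero η 1) := by
  have h : HasSum (fun m : ℤ => gauss η m) (thetaZero η 1) := by
    simpa [thetaZero] using (summable_theta hη one_ne_zero).hasSum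
  refine (((Equiv.addRight k).hasSum_iff.2 h).mul_left (gauss η k)⁻¹).congr_fun fun m => ?_
  have hk := gauss_ne_zero η k
  simp only [Function.comp_apply, Equiv.coe_addRight, gauss_add, ← zpow_mul, mul_comm k m]
  field_simp

theorem thetaZero_qPar {η : ℂ} (hη : η.im < 0) (k : ℤ) :
    thetaZero η (qPar η ^ k) = (gauss η k)⁻¹ * thetaZero η 1 :=
  (hasSum_theta_qPar hη k).tsum_eq

/-! ### The theta series of the Cherednik operator -/

theorem coeff_eq_zero_of_large (u : ℂ[T;T⁻¹]) :
    ∃ N : ℕ, ∀ n : ℤ, (N : ℤ) < |n| → u.coeff n = 0 := by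
  refine ⟨u.coeff.support.sup Int.natAbs, fun n hn => ?_⟩
  by_contra h
  rw [Int.abs_eq_natAbs] at hn
  have := Finset.le_sup (f := Int.natAbs) (Finsupp.mem_support_iff.2 h)
  omega

theorem zpow_apply_of_eigen (A : ℂ[T;T⁻¹] ≃ₗ[ℂ] ℂ[T;T⁻¹]) {u : ℂ[T;T⁻¹]} {a : ℂ} (ha : a ≠ 0)
    (h : A u = a • u) (m : ℤ) : (A ^ m) u = a ^ m • u := by
  have h' : A⁻¹ u = a⁻¹ • u := by
    change A.symm u = _
    rw [LinearEquiv.symm_apply_eq, map_smul, h, smul_smul, inv_mul_cancel₀ ha, one_smul]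
  induction m with
  | zero => simp
  | succ i ih =>
    rw [zpow_add_one, LinearEquiv.mul_apply, h, map_smul, ih, smul_smul, zpow_add_one₀ ha, mul_comm]
  | pred i ih =>
    rw [zpow_sub_one, LinearEquiv.mul_apply, h', map_smul, ih, smul_smul, zpow_sub_one₀ ha, mul_comm]

theorem IsThetaZeroY.add {η : ℂ} {f g f' g' : ℂ[T;T⁻¹]} (h : IsThetaZeroY η f g)
    (h' : IsThetaZeroY η f' g') : IsThetaZeroY η (f + f') (g + g') := by
  obtain ⟨⟨N, hN⟩, hs⟩ := h
  obtain ⟨⟨N', hN'⟩, hs'⟩ := h'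
  refine ⟨⟨max N N', fun m n hn => ?_⟩, fun n => ?_⟩
  · rw [map_add, AddMonoidAlgebra.coeff_add, Finsupp.add_apply, hN m n (by omega),
      hN' m n (by omega), add_zero]
  · simpa only [map_add, AddMonoidAlgebra.coeff_add, Finsupp.add_apply, mul_add] using
      (hs n).add (hs' n)

theorem IsThetaZeroY.smul {η : ℂ} {f g : ℂ[T;T⁻¹]} (h : IsThetaZeroY η f g) (a : ℂ) :
    IsThetaZeroY η (a • f) (a • g) := by
  obtain ⟨⟨N, hN⟩, hs⟩ := h
  refine ⟨⟨N, fun m n hn => ?_⟩, fun n => ?_⟩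
  · rw [map_smul, AddMonoidAlgebra.coeff_smul, Finsupp.smul_apply, hN m n hn, smul_zero]
  · simpa only [map_smul, AddMonoidAlgebra.coeff_smul, Finsupp.smul_apply, smul_eq_mul,
      mul_left_comm] using (hs n).mul_left a

theorem isThetaZeroY_of_eigen {η : ℂ} (hη : η.im < 0) {u : ℂ[T;T⁻¹]} {a : ℂ} (ha : a ≠ 0)
    (h : opY η u = a • u) : IsThetaZeroY η u (thetaZero η a • u) := by
  obtain ⟨N, hN⟩ := coeff_eq_zero_of_large u
  refine ⟨⟨N, fun m n hn => ?_⟩, fun n => ?_⟩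
  · rw [zpow_apply_of_eigen _ ha h, AddMonoidAlgebra.coeff_smul, Finsupp.smul_apply, hN n hn,
      smul_zero]
  · simp only [zpow_apply_of_eigen _ ha h, AddMonoidAlgebra.coeff_smul, Finsupp.smul_apply,
      smul_eq_mul]
    refine ((summable_theta hη ha).hasSum.mul_right (u.coeff n)).congr_fun fun m => ?_
    ring

/-- The span of v and Yv is Y-stable. The vectors Yv - a⁻¹v and av - Yv have eigenvalues a and a⁻¹
and add up to (a - a⁻¹)v; θ₀ takes the same value at a and a⁻¹. -/
theorem isThetaZeroY_of_add_symm {η : ℂ} (hη : η.im < 0) {v : ℂ[T;T⁻¹]} {a : ℂ} (ha : a ≠ 0)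
    (haa : a - a⁻¹ ≠ 0) (h : opY η v + (opY η).symm v = (a + a⁻¹) • v) :
    IsThetaZeroY η v (thetaZero η a • v) := by
  have hYY : opY η (opY η v) = (a + a⁻¹) • opY η v - v := by
    rw [← map_smul, ← h, map_add, LinearEquiv.apply_symm_apply, add_sub_cancel_right]
  have h1 : opY η (opY η v - a⁻¹ • v) = a • (opY η v - a⁻¹ • v) := by
    rw [map_sub, map_smul, hYY]
    match_scalars
    · ring
    · linear_combination mul_inv_cancel₀ ha
  have h2 : opY η (a • v - opY η v) = a⁻¹ • (a • v - opY η v) := by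
    rw [map_sub, map_smul, hYY]
    match_scalars
    · ring
    · linear_combination -mul_inv_cancel₀ ha
  have h3 := ((isThetaZeroY_of_eigen hη ha h1).add
    (isThetaZeroY_of_eigen hη (inv_ne_zero ha) h2)).smul (a - a⁻¹)⁻¹
  rw [thetaZero_inv, ← smul_add, smul_comm] at h3
  have e : (a - a⁻¹)⁻¹ • (opY η v - a⁻¹ • v + (a • v - opY η v)) = v := by
    rw [show opY η v - a⁻¹ • v + (a • v - opY η v) = (a - a⁻¹) • v by module, smul_smul,
      inv_mul_cancel₀ haa, one_smul]
  rwa [e] at h3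

theorem isThetaZeroY_macdonald {η : ℂ} (hη : η.im < 0) (j : ℕ) :
    IsThetaZeroY η (macdonald (qPar η) j)
      (thetaZero η (qPar η ^ (j + 2)) • macdonald (qPar η) j) := by
  have hq := qPar_ne_zero η
  have h0 := zpow_sub_zpow_neg_ne_zero hq (norm_qPar_lt_one hη) (show (0 : ℤ) < j + 2 by omega)
  have h := opY_add_symm_rodrigues η (j + 2)
  have e : qPar η ^ (j + 2 : ℤ) = qPar η ^ (j + 2) := by norm_cast
  rw [zpow_neg, e] at h h0
  rw [macdonald, ← smul_eq_C_mul, smul_comm]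
  rw [← smul_eq_C_mul] at h
  exact (isThetaZeroY_of_add_symm hη (pow_ne_zero _ hq) h0 h).smul _

/-! ### Evaluation -/

/-- The point `e^{πiz}` as a unit. -/
noncomputable def expUnit (z : ℂ) : ℂˣ := Units.mk0 (exp (Real.pi * I * z)) (exp_ne_zero _)

theorem toFun_eq_eval₂ (f : ℂ[T;T⁻¹]) (z : ℂ) :
    toFun f z = eval₂ (RingHom.id ℂ) (expUnit z) f := by
  induction f using LaurentPolynomial.induction_on' with
  | add p r hp hr =>
    rw [map_add, ← hp, ← hr, toFun, AddMonoidAlgebra.coeff_add]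
    exact Finsupp.sum_add_index' (by simp) (by intros; rw [add_mul])
  | C_mul_T n a =>
    rw [eval₂_C_mul_T, ← single_eq_C_mul_T, Units.val_zpow_eq_zpow_val]
    change (Finsupp.single n a).sum _ = _
    rw [Finsupp.sum_single_index] <;> simp [expUnit]

theorem toFun_add (f g : ℂ[T;T⁻¹]) (z : ℂ) : toFun (f + g) z = toFun f z + toFun g z := by
  simp only [toFun_eq_eval₂, map_add]

theorem toFun_sub (f g : ℂ[T;T⁻¹]) (z : ℂ) : toFun (f - g) z = toFun f z - toFun g z := by
  simp only [toFun_eq_eval₂, map_sub]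

theorem toFun_mul (f g : ℂ[T;T⁻¹]) (z : ℂ) : toFun (f * g) z = toFun f z * toFun g z := by
  simp only [toFun_eq_eval₂, map_mul]

theorem toFun_C (a z : ℂ) : toFun (C a) z = a := by
  rw [toFun_eq_eval₂, eval₂_C, RingHom.id_apply]

theorem toFun_smul (a : ℂ) (f : ℂ[T;T⁻¹]) (z : ℂ) : toFun (a • f) z = a * toFun f z := by
  rw [smul_eq_C_mul, toFun_mul, toFun_C]

theorem toFun_T (n : ℤ) (z : ℂ) : toFun (T n) z = exp (Real.pi * I * z) ^ n := by
  rw [toFun_eq_eval₂, eval₂_T, Units.val_zpow_eq_zpow_val, expUnit, Units.val_mk0]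

/-! ### The terms of T(q) in the variable x, where the shift by -2ηm becomes x ↦ q^m x. -/

theorem exp_sub_shift (η z : ℂ) (m : ℤ) :
    exp (Real.pi * I * (z - 2 * η * m)) = exp (Real.pi * I * z) * qPar η ^ m := by
  rw [qPar_zpow, ← exp_add]; congr 1; ring

theorem sin_pi_mul (u : ℂ) :
    sin (Real.pi * u) = -(I / 2) * (exp (Real.pi * I * u) - (exp (Real.pi * I * u))⁻¹) := by
  rw [sin, ← exp_neg]
  ring_nf

theorem cos_pi_mul (u : ℂ) :
    cos (Real.pi * u) = (exp (Real.pi * I * u) + (exp (Real.pi * I * u))⁻¹) / 2 := by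
  rw [cos, ← exp_neg]
  ring_nf

theorem sinDenom_eq (η z : ℂ) : sinDenom η z = I / 8 * toFun (weight (qPar η)) z := by
  have h1 := exp_sub_shift η z 1
  have h2 := exp_sub_shift η z (-1)
  rw [Int.cast_one, mul_one, zpow_one] at h1
  rw [Int.cast_neg, Int.cast_one, mul_neg_one, sub_neg_eq_add, zpow_neg_one] at h2
  simp only [sinDenom, sin_pi_mul, h1, h2, weight, toFun_mul, toFun_sub, toFun_C, toFun_T, zpow_one,
    zpow_neg_one, mul_inv, inv_inv]
  linear_combination (-(I / 8) *
    ((exp (Real.pi * I * z) * qPar η - (exp (Real.pi * I * z))⁻¹ * (qPar η)⁻¹) *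
      (exp (Real.pi * I * z) - (exp (Real.pi * I * z))⁻¹) *
      (exp (Real.pi * I * z) * (qPar η)⁻¹ - (exp (Real.pi * I * z))⁻¹ * qPar η))) * I_sq

theorem opNum_add (q : ℂ) (f g : ℂ[T;T⁻¹]) : opNum q (f + g) = opNum q f + opNum q g := by
  simp only [opNum, map_add]; ring

theorem opNum_C_mul (q a : ℂ) (f : ℂ[T;T⁻¹]) : opNum q (C a * f) = C a * opNum q f := by
  simp only [opNum, linearMap_C_mul]; ring

/-- Expanding the cosines times the sine in powers of q^m leaves the exponents 2, 0 and -2, so each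
term splits into three theta terms, at q^{n+2}, q^n and q^{n-2}. -/
theorem opTTerm_T {η z : ℂ} (hz : sinDenom η z ≠ 0) (n m : ℤ) :
    opTTerm η (toFun (T n)) z m =
      exp (Real.pi * I * z) ^ n / toFun (weight (qPar η)) z *
        ((exp (Real.pi * I * z) ^ 3 - (qPar η)⁻¹ ^ 2 * exp (Real.pi * I * z)) *
            ((qPar η ^ (n + 2)) ^ m * gauss η m) -
          ((qPar η)⁻¹ ^ 2 + 1) * (exp (Real.pi * I * z) - (exp (Real.pi * I * z))⁻¹) *
            ((qPar η ^ n) ^ m * gauss η m) +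
          ((qPar η)⁻¹ ^ 2 * (exp (Real.pi * I * z))⁻¹ - (exp (Real.pi * I * z))⁻¹ ^ 3) *
            ((qPar η ^ (n - 2)) ^ m * gauss η m)) := by
  have hq := qPar_ne_zero η
  have hx : exp (Real.pi * I * z) ≠ 0 := exp_ne_zero _
  rw [sinDenom_eq] at hz
  have hD := right_ne_zero_of_mul hz
  have c1 : exp (Real.pi * I * (2 * η * m)) = (qPar η ^ m)⁻¹ := by
    rw [← zpow_neg, qPar_zpow]; congr 1; push_cast; ring
  have c2 : exp (Real.pi * I * (2 * z)) = exp (Real.pi * I * z) ^ 2 := by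
    rw [← exp_nat_mul]; congr 1; push_cast; ring
  have p1 : (qPar η ^ (n + 2)) ^ m = (qPar η ^ m) ^ n * (qPar η ^ m) ^ 2 := by
    rw [← zpow_mul, mul_comm, zpow_mul, zpow_add₀ (zpow_ne_zero m hq)]; rfl
  have p2 : (qPar η ^ n) ^ m = (qPar η ^ m) ^ n := by rw [← zpow_mul, mul_comm, zpow_mul]
  have p3 : (qPar η ^ (n - 2)) ^ m = (qPar η ^ m) ^ n / (qPar η ^ m) ^ 2 := by
    rw [← zpow_mul, mul_comm, zpow_mul, zpow_sub₀ (zpow_ne_zero m hq)]; rfl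
  have p0 : qPar η ^ (-2 : ℤ) = (qPar η)⁻¹ ^ 2 := by rw [zpow_neg, inv_pow]; rfl
  rw [opTTerm, sinDenom_eq, sin_pi_mul, cos_pi_mul, cos_pi_mul, toFun_T,
    exp_sub_shift, exp_sub_shift, c1, c2,
    p1, p2, p3, p0, mul_zpow]
  have hQm : qPar η ^ m ≠ 0 := zpow_ne_zero m hq
  generalize qPar η ^ m = a at *
  generalize toFun (weight (qPar η)) z = D at *
  generalize exp (Real.pi * I * z) = x at *
  generalize x ^ n = y at *
  generalize a ^ n = b at *
  generalize gauss η m = G at *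
  generalize qPar η = q at *
  have hI : I ≠ 0 := I_ne_zero
  field_simp
  ring

theorem toFun_opNum_gaussOp_T (η z : ℂ) (n : ℤ) :
    toFun (opNum (qPar η) (gaussOp η (T n))) z =
      exp (Real.pi * I * z) ^ n *
        ((exp (Real.pi * I * z) ^ 3 - (qPar η)⁻¹ ^ 2 * exp (Real.pi * I * z)) *
            (gauss η (n + 2))⁻¹ -
          ((qPar η)⁻¹ ^ 2 + 1) * (exp (Real.pi * I * z) - (exp (Real.pi * I * z))⁻¹) *
            (gauss η n)⁻¹ +
          ((qPar η)⁻¹ ^ 2 * (exp (Real.pi * I * z))⁻¹ - (exp (Real.pi * I * z))⁻¹ ^ 3) *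
            (gauss η (n - 2))⁻¹) := by
  have hq := qPar_ne_zero η
  have g2 : gauss η 2 = qPar η ^ 2 := by
    rw [show (2 : ℤ) = 1 + 1 by norm_num, gauss_add, gauss_one_sq, mul_one, zpow_one, sq]
  have g3 : (gauss η (n + 2))⁻¹ = (gauss η n)⁻¹ * (qPar η)⁻¹ ^ 2 * ((qPar η)⁻¹ ^ 2) ^ n := by
    rw [gauss_add, g2, mul_inv, mul_inv, inv_pow, inv_zpow, mul_comm n 2, zpow_mul]; rfl
  have g4 : (gauss η (n - 2))⁻¹ = (gauss η n)⁻¹ * (qPar η)⁻¹ ^ 2 * (qPar η ^ 2) ^ n := by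
    rw [sub_eq_add_neg, gauss_add, gauss_neg, g2, mul_inv, mul_inv, inv_pow, mul_neg, zpow_neg,
      inv_inv, mul_comm n 2, zpow_mul]; rfl
  have z3 : exp (Real.pi * I * z) ^ (3 : ℤ) = exp (Real.pi * I * z) ^ 3 := rfl
  have z3' : exp (Real.pi * I * z) ^ (-3 : ℤ) = (exp (Real.pi * I * z))⁻¹ ^ 3 := by
    rw [zpow_neg, inv_pow]; rfl
  rw [gaussOp_T, opNum_C_mul, opNum, dilate_T, dilate_T, g3, g4]
  simp only [toFun_mul, toFun_add, toFun_sub, toFun_C, toFun_T, z3, z3', zpow_one, zpow_neg_one]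
  ring

/-- The operator `T(q)` on Laurent polynomials. -/
theorem hasSum_opTTerm {η : ℂ} (hη : η.im < 0) {z : ℂ} (hz : sinDenom η z ≠ 0) (f : ℂ[T;T⁻¹]) :
    HasSum (opTTerm η (toFun f) z)
      (thetaZero η 1 * toFun (opNum (qPar η) (gaussOp η f)) z / toFun (weight (qPar η)) z) := by
  induction f using LaurentPolynomial.induction_on' with
  | add p r hp hr =>
    rw [map_add, opNum_add, toFun_add, mul_add, add_div]
    refine (hp.add hr).congr_fun fun m => ?_
    simp only [opTTerm, toFun_add]
    ring
  | C_mul_T n a =>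
    rw [linearMap_C_mul, opNum_C_mul, toFun_mul, toFun_C, toFun_opNum_gaussOp_T]
    have h := ((((hasSum_theta_qPar hη (n + 2)).mul_left
      (exp (Real.pi * I * z) ^ 3 - (qPar η)⁻¹ ^ 2 * exp (Real.pi * I * z))).sub
      ((hasSum_theta_qPar hη n).mul_left
        (((qPar η)⁻¹ ^ 2 + 1) * (exp (Real.pi * I * z) - (exp (Real.pi * I * z))⁻¹)))).add
      ((hasSum_theta_qPar hη (n - 2)).mul_left
        ((qPar η)⁻¹ ^ 2 * (exp (Real.pi * I * z))⁻¹ - (exp (Real.pi * I * z))⁻¹ ^ 3))).mul_left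
      (a * (exp (Real.pi * I * z) ^ n / toFun (weight (qPar η)) z))
    have hterm : opTTerm η (toFun (C a * T n)) z = fun m => a * opTTerm η (toFun (T n)) z m := by
      funext m
      simp only [opTTerm, toFun_mul, toFun_C]
      ring
    rw [hterm]
    simp only [opTTerm_T hz, ← mul_assoc a]
    refine (congrArg (HasSum _) ?_).mp h
    ring

/-! ### Comparison of the two operators on symmetric polynomials. -/

theorem hasSum_opTTerm_macdonald {η : ℂ} (hη : η.im < 0) {z : ℂ} (hz : sinDenom η z ≠ 0) (j : ℕ) :
    HasSum (opTTerm η (toFun (macdonald (qPar η) j)) z)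
      (thetaZero η (qPar η ^ (j + 2)) * toFun (macdonald (qPar η) j) z) := by
  have hD : toFun (weight (qPar η)) z ≠ 0 := by
    rw [sinDenom_eq] at hz
    exact right_ne_zero_of_mul hz
  have e : qPar η ^ (j + 2) = qPar η ^ (j + 2 : ℤ) := by norm_cast
  convert hasSum_opTTerm hη hz (macdonald (qPar η) j) using 1
  rw [macdonald, linearMap_C_mul, opNum_C_mul, opNum_gaussOp_rodrigues, e, thetaZero_qPar hη]
  simp only [toFun_mul, toFun_C]
  field_simp

/-- Symmetric Laurent polynomials are spanned by the Macdonald polynomials. -/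
theorem symmetric_induction {q : ℂ} (hq : q ≠ 0) (hq1 : ‖q‖ < 1) {p : ℂ[T;T⁻¹] → Prop}
    (h0 : p 0) (hadd : ∀ f g, p f → p g → p (f + g)) (hsmul : ∀ (a : ℂ) f, p f → p (a • f))
    (hmac : ∀ j, p (macdonald q j)) (f : ℂ[T;T⁻¹]) (hf : invert f = f) : p f := by
  have key : ∀ (N : ℕ) (f : ℂ[T;T⁻¹]), invert f = f → (∀ n : ℤ, (N : ℤ) ≤ n → f.coeff n = 0) →
      p f := by
    intro N
    induction N with
    | zero =>
      intro f hf hN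
      have : f = 0 := LaurentPolynomial.ext fun n => by
        rcases le_total 0 n with h | h
        · exact hN n (by simpa using h)
        · rw [← hf, invert_apply]; exact hN (-n) (by simpa using h)
      rwa [this]
    | succ N ih =>
      intro f hf hN
      -- Subtracting the multiple of the monic polynomial of degree N cancels the top coefficient
      -- and lowers the strict degree bound from N + 1 to N.
      rw [← sub_add_cancel f (f.coeff N • macdonald q N)]
      refine hadd _ _ (ih _ ?_ fun n hn => ?_) (hsmul _ _ (hmac N))
      · rw [map_sub, map_smul, hf, invert_macdonald]
      · rw [AddMonoidAlgebra.coeff_sub, Finsupp.sub_apply, AddMonoidAlgebra.coeff_smul,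
          Finsupp.smul_apply, smul_eq_mul]
        rcases eq_or_lt_of_le hn with rfl | h
        · rw [coeff_macdonald_self hq hq1, mul_one, sub_self]
        · rw [coeff_macdonald_of_lt q h, hN n (by omega), mul_zero, sub_zero]
  obtain ⟨N, hN⟩ := coeff_eq_zero_of_large f
  exact key (N + 1) f hf fun n hn => hN n (by rw [abs_of_nonneg] <;> omega)

/-- The conditions on (f, g) are linear, so the Macdonald polynomials suffice. There one eigenvalue
serves both operators, so a single g does for both. -/
theorem exists_thetaZeroY {η : ℂ} (hη : η.im < 0) (f : ℂ[T;T⁻¹]) (hf : invert f = f) :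
    ∃ g : ℂ[T;T⁻¹], invert g = g ∧ IsThetaZeroY η f g ∧
      ∀ z : ℂ, sinDenom η z ≠ 0 → HasSum (opTTerm η (toFun f) z) (toFun g z) := by
  revert f
  refine symmetric_induction (qPar_ne_zero η) (norm_qPar_lt_one hη) ?_ ?_ ?_ fun j => ?_
  · refine ⟨0, map_zero _, ⟨⟨0, fun m n _ => by simp⟩, fun n => by simp⟩, fun z _ => ?_⟩
    convert hasSum_zero using 1
    · funext m
      simp [opTTerm, toFun]
    · simp [toFun]
  · rintro f f' ⟨g, hg, hY, hT⟩ ⟨g', hg', hY', hT'⟩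
    refine ⟨g + g', by rw [map_add, hg, hg'], hY.add hY', fun z hz => ?_⟩
    rw [toFun_add]
    refine ((hT z hz).add (hT' z hz)).congr_fun fun m => ?_
    simp only [opTTerm, toFun_add]
    ring
  · rintro a f ⟨g, hg, hY, hT⟩
    refine ⟨a • g, by rw [map_smul, hg], hY.smul a, fun z hz => ?_⟩
    rw [toFun_smul]
    refine ((hT z hz).mul_left a).congr_fun fun m => ?_
    simp only [opTTerm, toFun_smul]
    ring
  · refine ⟨_, ?_, isThetaZeroY_macdonald hη j, fun z hz => ?_⟩
    · rw [map_smul, invert_macdonald]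
    · rw [toFun_smul]
      exact hasSum_opTTerm_macdonald hη hz j

end EllipticMacdonald

theorem mainTheorem12 (η : ℂ) (hη : η.im < 0) :
    (∃! P : ℕ → LaurentPolynomial ℂ,
      EllipticMacdonald.IsMacdonald (EllipticMacdonald.qPar η) 2 P) ∧
    (∀ x : ℂ, x ≠ 0 → Summable fun m : ℤ => x ^ m * EllipticMacdonald.gauss η m) ∧
    (∀ P : ℕ → LaurentPolynomial ℂ,
      EllipticMacdonald.IsMacdonald (EllipticMacdonald.qPar η) 2 P →
      ∀ (j : ℕ) (z : ℂ), EllipticMacdonald.sinDenom η z ≠ 0 →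
        Summable (EllipticMacdonald.opTTerm η (EllipticMacdonald.toFun (P j)) z) ∧
        EllipticMacdonald.opT η (EllipticMacdonald.toFun (P j)) z =
          EllipticMacdonald.thetaZero η (EllipticMacdonald.qPar η ^ (j + 2)) *
            EllipticMacdonald.toFun (P j) z) ∧
    (∀ f : LaurentPolynomial ℂ, LaurentPolynomial.invert f = f →
      ∃ g : LaurentPolynomial ℂ, LaurentPolynomial.invert g = g ∧
        EllipticMacdonald.IsThetaZeroY η f g ∧
        ∀ z : ℂ, EllipticMacdonald.sinDenom η z ≠ 0 →
          Summable (EllipticMacdonald.opTTerm η (EllipticMacdonald.toFun f) z) ∧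
          EllipticMacdonald.opT η (EllipticMacdonald.toFun f) z =
            EllipticMacdonald.toFun g z) := by
  have hq := EllipticMacdonald.qPar_ne_zero η
  have hq1 := EllipticMacdonald.norm_qPar_lt_one hη
  refine ⟨⟨_, EllipticMacdonald.isMacdonald_macdonald hq hq1, fun P hP => hP.eq_macdonald hq hq1⟩,
    fun x hx => EllipticMacdonald.summable_theta hη hx, fun P hP j z hz => ?_, fun f hf => ?_⟩
  · rw [hP.eq_macdonald hq hq1]
    have h := EllipticMacdonald.hasSum_opTTerm_macdonald hη hz j
    exact ⟨h.summable, h.tsum_eq⟩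
  · obtain ⟨g, hg, hY, hT⟩ := EllipticMacdonald.exists_thetaZeroY hη f hf
    exact ⟨g, hg, hY, fun z hz => ⟨(hT z hz).summable, (hT z hz).tsum_eq⟩⟩
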